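/- Theorem 5.7. A *dendrite* is a nonempty compact connected locally connected metric space that contains no simple closed curve (no subspace homeomorphic to the circle). For a continuous self-map $f\colon X\to X$ of a nonempty compact metric space $(X,d)$, a set $S\subseteq X$ is $(n,\varepsilon,f)$-*separated* if $\max_{0\le i\le n-1} d(f^i(x),f^i(y))>\varepsilon$ for all distinct $x,y\in S$; let $\operatorname{sep}(n,\varepsilon,f)$ be the maximal cardinality of an $(n,\varepsilon,f)$-separated subset of $X$. The *polynomial entropy* of $f$ is $$h_{\mathrm{pol}}(f)=\lim_{\varepsilon\to 0^+}\ \limsup_{n\to\infty}\frac{\log \operatorname{sep}(n,\varepsilon,f)}{\log n}\in[0,\infty].$$ For every real number $\alpha\in(2,3)$ there is a dendrite $D$ and a continuous surjective map $f\colon D\to D$ with $h_{\mathrm{pol}}(f)=\alpha$. -/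

import Mathlib

open Set Filter Topology

/-- A set `S` is `(n, ε, f)`-separated if for any two distinct points `x, y ∈ S` one has
`max_{0 ≤ i ≤ n - 1} d(f^i x, f^i y) > ε`, that is, `d(f^i x, f^i y) > ε` for some `i < n`. -/
def IsDynSeparated {X : Type*} [MetricSpace X] (f : X → X) (n : ℕ) (ε : ℝ) (S : Set X) : Prop :=
  ∀ x ∈ S, ∀ y ∈ S, x ≠ y → ∃ i < n, ε < dist (f^[i] x) (f^[i] y)

/-- The maximal cardinality of an `(n, ε, f)`-separated subset of `X`. (It is finite if `X` is
compact, `f` is continuous and `ε > 0`.) -/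
noncomputable def sepNumber {X : Type*} [MetricSpace X] (f : X → X) (n : ℕ) (ε : ℝ) : ℕ∞ :=
  ⨆ (S : Set X) (_ : IsDynSeparated f n ε S), S.encard

/-- The polynomial entropy of `f` at scale `ε`,
`limsup_{n → ∞} log sep(n, ε, f) / log n`, as an extended real number. -/
noncomputable def polyEntropyAt {X : Type*} [MetricSpace X] (f : X → X) (ε : ℝ) : EReal :=
  limsup (fun n : ℕ => ENNReal.log (sepNumber f n ε : ENNReal) / (Real.log n : EReal)) atTop

/-- The polynomial entropy of `f`. The limit as `ε → 0⁺` of `polyEntropyAt f ε` is taken as the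
supremum over `ε > 0`; see `tendsto_polyEntropyAt`. -/
noncomputable def polyEntropy {X : Type*} [MetricSpace X] (f : X → X) : EReal :=
  ⨆ ε ∈ Ioi (0 : ℝ), polyEntropyAt f ε

/-- A dendrite: a nonempty compact connected metric space (a continuum) which is locally
connected and contains no simple closed curve, i.e. no subspace homeomorphic to the circle. -/
structure IsDendrite (X : Type*) [MetricSpace X] : Prop where
  compact : CompactSpace X
  connected : ConnectedSpace X
  locallyConnected : LocallyConnectedSpace X
  no_simple_closed_curve : ∀ γ : Circle → X, ¬ IsEmbedding γ

theorem polyEntropyAt_antitone {X : Type*} [MetricSpace X] (f : X → X) :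
    Antitone (polyEntropyAt f) := by
  intro ε₁ ε₂ h
  refine limsup_le_limsup (Eventually.of_forall fun n => ?_)
  refine EReal.div_le_div_right_of_nonneg (by exact_mod_cast Real.log_natCast_nonneg n) ?_
  refine ENNReal.log_monotone ?_
  have : sepNumber f n ε₂ ≤ sepNumber f n ε₁ := by
    refine biSup_mono fun S hS x hx y hy hxy => ?_
    obtain ⟨i, hi, hd⟩ := hS x hx y hy hxy
    exact ⟨i, hi, h.trans_lt hd⟩
  exact_mod_cast this

/-- The supremum defining the polynomial entropy is the limit as `ε → 0⁺`. -/
theorem tendsto_polyEntropyAt {X : Type*} [MetricSpace X] (f : X → X) :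
    Tendsto (polyEntropyAt f) (𝓝[>] 0) (𝓝 (polyEntropy f)) := by
  have := (polyEntropyAt_antitone f).tendsto_nhdsGT 0
  rwa [sSup_image] at this

/-! Put γ = α - 2 ∈ (0, 1). Take the subshift of ±1 sequences with at most two 1's, the gap between
them lying in a set G with about n^γ elements below n. It has about n · n^γ words of length n: a
first position and a gap. Now make its sequences ends of a tree: a point of `GapTree G` follows a
word up to some height and stops there at a real coordinate, and the shift acts on these points as
well. The height contributes one more factor n and the last coordinate, at fixed ε, a bounded one,
so separated sets have order n^(2+γ). The two bounds are `sepNumber_shift_le` and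
`le_sepNumber_shift`; `polyEntropy_shift` takes logarithms.

The tree is a closed subset of a product of intervals, hence compact. Sliding points towards the
root gives connectedness, globally by `contract` and inside small boxes by `exists_contract_eq`. Any
two points are separated by a third (`separatedByPoint`), while removing a point never disconnects a
circle, so no circle embeds. -/

/-! ### Cut points exclude circles. -/

theorem Circle.isPreconnected_compl_singleton (z : Circle) : IsPreconnected ({z}ᶜ : Set Circle) := by
  obtain ⟨a, rfl⟩ := Circle.exp_surjective z
  have : ({Circle.exp a}ᶜ : Set Circle) = Circle.exp '' Ioo a (a + 2 * Real.pi) := by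
    ext w
    simp only [mem_compl_iff, mem_singleton_iff, mem_image]
    constructor
    · intro hw
      obtain ⟨b, rfl⟩ := Circle.exp_surjective w
      obtain ⟨c, hc, hbc⟩ : ∃ c ∈ Ico a (a + 2 * Real.pi), Circle.exp c = Circle.exp b := by
        refine ⟨toIcoMod Real.two_pi_pos a b, toIcoMod_mem_Ico _ _ _, ?_⟩
        rw [toIcoMod, Circle.periodic_exp.sub_zsmul_eq]
      refine ⟨c, ⟨lt_of_le_of_ne hc.1 ?_, hc.2⟩, hbc⟩
      rintro rfl
      exact hw hbc.symm
    · rintro ⟨c, hc, rfl⟩ h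
      obtain ⟨m, hm⟩ := Circle.exp_eq_exp.1 h
      have hpi := Real.pi_pos
      have h1 : (0 : ℝ) < m := by
        by_contra hneg
        nlinarith [hc.1]
      have h2 : (m : ℝ) < 1 := by
        by_contra hneg
        nlinarith [hc.2]
      norm_cast at h1 h2
      omega
  rw [this]
  exact isPreconnected_Ioo.image _ Circle.exp.continuous.continuousOn

/-- `x` and `y` lie in different parts of a partition of the complement of a point `p` into two
open sets. -/
def SeparatedByPoint {X : Type*} [TopologicalSpace X] (x y : X) : Prop :=
  ∃ (p : X) (A B : Set X), IsOpen A ∧ IsOpen B ∧ Disjoint A B ∧ x ∈ A ∧ y ∈ B ∧ p ∉ A ∧ p ∉ B ∧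
    {p}ᶜ ⊆ A ∪ B

theorem SeparatedByPoint.symm {X : Type*} [TopologicalSpace X] {x y : X}
    (h : SeparatedByPoint x y) : SeparatedByPoint y x := by
  obtain ⟨p, A, B, hA, hB, hd, hx, hy, hpA, hpB, hc⟩ := h
  exact ⟨p, B, A, hB, hA, hd.symm, hy, hx, hpB, hpA, union_comm A B ▸ hc⟩

theorem not_isEmbedding_circle {X : Type*} [TopologicalSpace X]
    (h : ∀ x y : X, x ≠ y → SeparatedByPoint x y) (γ : Circle → X) : ¬ IsEmbedding γ := by
  intro hγ
  have hne : Circle.exp 0 ≠ Circle.exp Real.pi := by simp [Circle.ext_iff]; norm_num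
  obtain ⟨p, A, B, hA, hB, hd, hx, hy, hpA, hpB, hc⟩ := h _ _ (hγ.injective.ne hne)
  have key : IsPreconnected (γ ⁻¹' {p}ᶜ) := by
    by_cases hp : ∃ z, γ z = p
    · obtain ⟨z, rfl⟩ := hp
      convert Circle.isPreconnected_compl_singleton z using 1
      ext w
      simp [hγ.injective.eq_iff]
    · convert isPreconnected_univ (α := Circle) using 1
      ext w
      simpa using fun hw => hp ⟨w, hw⟩
  have hx' : γ (Circle.exp 0) ∈ ({p}ᶜ : Set X) := fun hxp => hpA (hxp ▸ hx)
  have hy' : γ (Circle.exp Real.pi) ∈ ({p}ᶜ : Set X) := fun hyp => hpB (hyp ▸ hy)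
  obtain ⟨w, -, hwA, hwB⟩ := key (γ ⁻¹' A) (γ ⁻¹' B) (hA.preimage hγ.continuous)
    (hB.preimage hγ.continuous) (fun w hw => hc hw) ⟨_, hx', hx⟩ ⟨_, hy', hy⟩
  exact disjoint_left.1 hd hwA hwB

/-! ### The tree and the contraction factors. -/

/-- A sequence in `[-1, 1]` encodes a point of a tree: the sequence of its signs, up to the first
coordinate of absolute value less than one, is the itinerary of the branch leading to the point,
and that coordinate locates the point on the last edge. The signs allow at most two positive
coordinates, whose distance minus one has to belong to `G`. -/
structure IsGapPoint (G : Set ℕ) (u : ℕ → ℝ) : Prop where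
  abs_le_one : ∀ k, |u k| ≤ 1
  eq_zero_or : ∀ k, u (k + 1) = 0 ∨ |u k| = 1
  gap_mem : ∀ i g, 0 < u i → 0 < u (i + g + 1) → g ∈ G
  nonpos_of_lt : ∀ i j k, i < j → j < k → 0 < u i → 0 < u j → u k ≤ 0

def GapTree (G : Set ℕ) : Type := {u : ℕ → ℝ // IsGapPoint G u}

noncomputable instance (G : Set ℕ) : MetricSpace (GapTree G) :=
  MetricSpace.induced Subtype.val Subtype.val_injective PiCountable.metricSpace

namespace IsGapPoint

variable {G : Set ℕ} {u : ℕ → ℝ}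

theorem eq_zero_of_lt (hu : IsGapPoint G u) {j k : ℕ} (hj : |u j| ≠ 1) (hjk : j < k) :
    u k = 0 := by
  induction k, hjk using Nat.le_induction with
  | base => exact (hu.eq_zero_or j).resolve_right hj
  | succ k _ ih => exact (hu.eq_zero_or k).resolve_right (by simp [ih])

theorem abs_eq_one_of_lt (hu : IsGapPoint G u) {j k : ℕ} (hk : u k ≠ 0) (hjk : j < k) :
    |u j| = 1 := by
  by_contra h
  exact hk (hu.eq_zero_of_lt h hjk)

/-- Nonnegative factors create no new positive coordinates, so the sign conditions survive; `hc'`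
repeats for `c` the rule that nothing follows an incomplete coordinate. -/
theorem mul (hu : IsGapPoint G u) {c : ℕ → ℝ} (hc : ∀ k, c k ∈ Icc (0 : ℝ) 1)
    (hc' : ∀ k, c (k + 1) = 0 ∨ c k = 1) : IsGapPoint G (fun k => c k * u k) := by
  have pos : ∀ {k}, 0 < c k * u k → 0 < u k := fun {k} h => pos_of_mul_pos_right h (hc k).1
  refine ⟨fun k => ?_, fun k => ?_, fun i g hi hg => hu.gap_mem i g (pos hi) (pos hg),
    fun i j k hij hjk hi hj => ?_⟩
  · rw [abs_mul, abs_of_nonneg (hc k).1]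
    exact mul_le_one₀ (hc k).2 (abs_nonneg _) (hu.abs_le_one k)
  · rcases hc' k with h | h
    · simp [h]
    · rcases hu.eq_zero_or k with h' | h'
      · simp [h']
      · simp [h, h']
  · exact mul_nonpos_of_nonneg_of_nonpos (hc k).1 (hu.nonpos_of_lt i j k hij hjk (pos hi) (pos hj))

end IsGapPoint

/-- The factor by which the `k`-th coordinate is multiplied at time `r` of the contraction of the
tree to its root. -/
noncomputable def contractionFactor (k : ℕ) (r : ℝ) : ℝ := max 0 (min 1 (2 - 2 ^ k * r))

theorem contractionFactor_mem (k : ℕ) (r : ℝ) : contractionFactor k r ∈ Icc (0 : ℝ) 1 :=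
  ⟨le_max_left _ _, max_le zero_le_one (min_le_left _ _)⟩

theorem continuous_contractionFactor (k : ℕ) : Continuous (contractionFactor k) := by
  unfold contractionFactor
  fun_prop

theorem antitone_contractionFactor (k : ℕ) : Antitone (contractionFactor k) := by
  intro r s h
  unfold contractionFactor
  gcongr

theorem contractionFactor_eq_zero {k : ℕ} {r : ℝ} (h : 2 ≤ 2 ^ k * r) :
    contractionFactor k r = 0 := by
  rw [contractionFactor, max_eq_left]
  exact (min_le_right _ _).trans (by linarith)

theorem contractionFactor_eq_one {k : ℕ} {r : ℝ} (h : 2 ^ k * r ≤ 1) :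
    contractionFactor k r = 1 := by
  rw [contractionFactor, min_eq_left (by linarith), max_eq_right zero_le_one]

theorem contractionFactor_succ (k : ℕ) (r : ℝ) :
    contractionFactor (k + 1) r = 0 ∨ contractionFactor k r = 1 := by
  rcases le_total 1 (2 ^ k * r) with h | h
  · exact Or.inl (contractionFactor_eq_zero (by rw [pow_succ]; linarith))
  · exact Or.inr (contractionFactor_eq_one h)

/-- Coordinate k shrinks exactly while 1 ≤ 2^k r ≤ 2. These time intervals overlap only at
endpoints, so coordinates disappear one after another, the deepest first, and a single time stops
the motion at any prescribed point of edge j. -/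
theorem exists_contractionFactor (j : ℕ) {t : ℝ} (ht : t ∈ Icc (0 : ℝ) 1) :
    ∃ ρ, 0 ≤ ρ ∧ contractionFactor j ρ = t ∧ (∀ k < j, ∀ r ≤ ρ, contractionFactor k r = 1) ∧
      ∀ k > j, contractionFactor k ρ = 0 := by
  have hj : (0 : ℝ) < 2 ^ j := by positivity
  have e : 2 ^ j * ((2 - t) / 2 ^ j) = 2 - t := by field_simp
  have h0 : 0 ≤ (2 - t) / 2 ^ j := div_nonneg (by linarith [ht.2]) hj.le
  refine ⟨(2 - t) / 2 ^ j, h0, ?_, fun k hk r hr => contractionFactor_eq_one ?_,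
    fun k hk => contractionFactor_eq_zero ?_⟩
  · rw [contractionFactor, e, sub_sub_cancel, min_eq_right ht.2, max_eq_right ht.1]
  · have h2 : (2 : ℝ) ^ k * 2 ≤ 2 ^ j := by
      rw [← pow_succ]
      exact pow_le_pow_right₀ one_le_two hk
    have h3 : (2 : ℝ) ^ k * r ≤ 2 ^ k * ((2 - t) / 2 ^ j) := by gcongr
    nlinarith [ht.1]
  · have h2 : (2 : ℝ) ^ j * 2 ≤ 2 ^ k := by
      rw [← pow_succ]
      exact pow_le_pow_right₀ one_le_two hk
    nlinarith [ht.2]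

/-! ### The tree is a dendrite. -/

namespace GapTree

variable {G : Set ℕ}

theorem isInducing_val : IsInducing (fun u : GapTree G => u.1) := ⟨rfl⟩

theorem continuous_apply (k : ℕ) : Continuous (fun u : GapTree G => u.1 k) :=
  (_root_.continuous_apply k).comp isInducing_val.continuous

theorem continuous_iff {X : Type*} [TopologicalSpace X] {g : X → GapTree G} :
    Continuous g ↔ ∀ k, Continuous fun x => (g x).1 k := by
  rw [isInducing_val.continuous_iff, continuous_pi_iff]
  rfl

theorem mem_nhds_iff {u : GapTree G} {U : Set (GapTree G)} :
    U ∈ 𝓝 u ↔ ∃ N : ℕ, ∃ δ > 0, {v : GapTree G | ∀ k < N, |v.1 k - u.1 k| ≤ δ} ⊆ U := by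
  constructor
  · intro hU
    rw [isInducing_val.nhds_eq_comap, mem_comap] at hU
    obtain ⟨W, hW, hWU⟩ := hU
    rw [nhds_pi, Filter.mem_pi] at hW
    obtain ⟨I, hI, t, ht, htW⟩ := hW
    have hδ : ∀ i, ∃ δ > 0, ∀ x, |x - u.1 i| ≤ δ → x ∈ t i := fun i => by
      obtain ⟨δ, hδ, h⟩ := Metric.nhds_basis_closedBall.mem_iff.1 (ht i)
      exact ⟨δ, hδ, fun x hx => h (by rwa [Metric.mem_closedBall, Real.dist_eq])⟩
    choose δ hδ h using hδ
    obtain ⟨N, hN⟩ := hI.bddAbove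
    have hfin := (Finset.range (N + 1)).exists_mem_eq_inf' ⟨0, by simp⟩ δ
    refine ⟨N + 1, (Finset.range (N + 1)).inf' ⟨0, by simp⟩ δ, ?_, fun v hv => hWU (htW ?_)⟩
    · obtain ⟨i, -, hi⟩ := hfin
      exact hi ▸ hδ i
    · intro i hi
      have hiN : i < N + 1 := Nat.lt_succ_of_le (hN hi)
      exact h i _ ((hv i hiN).trans (Finset.inf'_le _ (by simpa using hiN)))
  · rintro ⟨N, δ, hδ, h⟩
    refine mem_of_superset ?_ h
    have : {v : GapTree G | ∀ k < N, |v.1 k - u.1 k| ≤ δ} =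
        ⋂ k ∈ Finset.range N, {v : GapTree G | |v.1 k - u.1 k| ≤ δ} := by
      ext v
      simp
    rw [this, Filter.biInter_finset_mem]
    intro k _
    filter_upwards [(continuous_apply k).continuousAt (x := u) (Metric.closedBall_mem_nhds _ hδ)]
      with v hv
    simpa [Real.dist_eq] using hv

instance : CompactSpace (GapTree G) := by
  have hK : IsCompact {u : ℕ → ℝ | IsGapPoint G u} := by
    refine (isCompact_univ_pi fun _ : ℕ => isCompact_Icc (a := (-1 : ℝ)) (b := 1)).of_isClosed_subset
      ?_ fun u hu k _ => abs_le.1 (hu.abs_le_one k)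
    -- Implications with open hypotheses `0 < u i` turn into unions of closed conditions `u i ≤ 0`.
    have : {u : ℕ → ℝ | IsGapPoint G u} = (⋂ k, {u | |u k| ≤ 1}) ∩
        (⋂ k, {u | u (k + 1) = 0} ∪ {u | |u k| = 1}) ∩
        (⋂ (i) (g) (_ : g ∉ G), {u | u i ≤ 0} ∪ {u | u (i + g + 1) ≤ 0}) ∩
        (⋂ (i) (j) (k) (_ : i < j) (_ : j < k), {u | u i ≤ 0} ∪ ({u | u j ≤ 0} ∪ {u | u k ≤ 0})) := by
      ext u
      simp only [mem_inter_iff, mem_iInter, mem_union, mem_ofPred_eq]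
      constructor
      · rintro ⟨h1, h2, h3, h4⟩
        refine ⟨⟨⟨h1, h2⟩, fun i g hg => ?_⟩, fun i j k hij hjk => ?_⟩
        · by_contra! h
          exact hg (h3 i g h.1 h.2)
        · by_contra! h
          exact (h4 i j k hij hjk h.1 h.2.1).not_gt h.2.2
      · rintro ⟨⟨⟨h1, h2⟩, h3⟩, h4⟩
        refine ⟨h1, h2, fun i g hi hg => ?_, fun i j k hij hjk hi hj => ?_⟩
        · by_contra h
          rcases h3 i g h with h | h <;> linarith
        · rcases h4 i j k hij hjk with h | h | h <;> linarith
    rw [this]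
    have hc : ∀ k, Continuous fun u : ℕ → ℝ => u k := fun k => _root_.continuous_apply k
    refine (((isClosed_iInter fun k => ?_).inter (isClosed_iInter fun k => ?_)).inter
      (isClosed_iInter fun i => isClosed_iInter fun g => isClosed_iInter fun _ => ?_)).inter
      (isClosed_iInter fun i => isClosed_iInter fun j => isClosed_iInter fun k =>
        isClosed_iInter fun _ => isClosed_iInter fun _ => ?_)
    · exact isClosed_le (hc k).abs continuous_const
    · exact (isClosed_eq (hc _) continuous_const).union (isClosed_eq (hc k).abs continuous_const)
    · exact (isClosed_le (hc _) continuous_const).union (isClosed_le (hc _) continuous_const)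
    · exact (isClosed_le (hc _) continuous_const).union
        ((isClosed_le (hc _) continuous_const).union (isClosed_le (hc _) continuous_const))
  exact isCompact_iff_compactSpace.1 hK

/-- The contraction of the tree to its root. -/
noncomputable def contract (r : ℝ) (u : GapTree G) : GapTree G :=
  ⟨fun k => contractionFactor k r * u.1 k,
    u.2.mul (fun k => contractionFactor_mem k r) fun k => contractionFactor_succ k r⟩

theorem contract_apply (r : ℝ) (u : GapTree G) (k : ℕ) :
    (contract r u).1 k = contractionFactor k r * u.1 k := rfl

theorem contract_zero (u : GapTree G) : contract 0 u = u := by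
  refine Subtype.ext (funext fun k => ?_)
  rw [contract_apply, contractionFactor_eq_one (by simp), one_mul]

theorem isPreconnected_contract_image (u : GapTree G) (ρ : ℝ) :
    IsPreconnected ((fun r => contract r u) '' Icc 0 ρ) := by
  refine isPreconnected_Icc.image _ (Continuous.continuousOn (continuous_iff.2 fun k => ?_))
  exact (continuous_contractionFactor k).mul continuous_const

instance : ConnectedSpace (GapTree G) := by
  have h0 : IsGapPoint G 0 := ⟨by simp, by simp, by simp, by simp⟩
  have : Nonempty (GapTree G) := ⟨⟨0, h0⟩⟩
  suffices h : IsPreconnected (univ : Set (GapTree G)) from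
    { isPreconnected_univ := h, toNonempty := this }
  refine isPreconnected_of_forall ⟨0, h0⟩ fun u _ =>
    ⟨(fun r => contract r u) '' Icc 0 2, subset_univ _, ⟨2, ⟨zero_le_two, le_rfl⟩, ?_⟩,
      ⟨0, ⟨le_rfl, zero_le_two⟩, contract_zero u⟩, isPreconnected_contract_image u 2⟩
  refine Subtype.ext (funext fun k => ?_)
  have : (1 : ℝ) ≤ 2 ^ k := one_le_pow₀ one_le_two
  rw [contract_apply, contractionFactor_eq_zero (by linarith), zero_mul]
  rfl

theorem exists_first_ne {u v : GapTree G} (h : u ≠ v) :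
    ∃ j, u.1 j ≠ v.1 j ∧ ∀ k < j, u.1 k = v.1 k := by
  classical
  have h' : ∃ j, u.1 j ≠ v.1 j := by
    by_contra! h'
    exact h (Subtype.ext (funext h'))
  exact ⟨Nat.find h', Nat.find_spec h', fun k hk => not_not.1 (Nat.find_min h' hk)⟩

/-- Points of a small box around `u` reach a common point with `u` under the contraction, without
leaving the box. -/
theorem exists_contract_eq {u v : GapTree G} {N : ℕ} {δ : ℝ} (hδ : δ < 1) (hne : u ≠ v)
    (hv : ∀ k < N, |v.1 k - u.1 k| ≤ δ) :
    ∃ ρ ρ', 0 ≤ ρ ∧ 0 ≤ ρ' ∧ contract ρ u = contract ρ' v ∧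
      (∀ r ∈ Icc 0 ρ, ∀ k < N, |(contract r u).1 k - u.1 k| ≤ δ) ∧
      ∀ r ∈ Icc 0 ρ', ∀ k < N, |(contract r v).1 k - u.1 k| ≤ δ := by
  obtain ⟨j, hj, hlt⟩ := exists_first_ne hne
  have shrink : ∀ {c x : ℝ}, c ∈ Icc (0 : ℝ) 1 → |x| ≤ δ → |c * x| ≤ δ ∧ |c * x - x| ≤ δ := by
    intro c x hc hx
    have := abs_nonneg x
    refine ⟨?_, ?_⟩
    · rw [abs_mul, abs_of_nonneg hc.1]
      nlinarith [hc.2]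
    · rw [← sub_one_mul, abs_mul, abs_of_nonpos (by linarith [hc.2])]
      nlinarith [hc.1, hc.2]
  -- Both points retreat to the branch point where coordinate j is 0. If N ≤ j, the box does not
  -- constrain the coordinates that move. If the signs at j are not equal, closeness makes both
  -- coordinates at most δ < 1 in modulus, so all later ones vanish.
  by_cases hcase : N ≤ j ∨ u.1 j * v.1 j ≤ 0
  · obtain ⟨ρ, hρ, h1, h2, h3⟩ := exists_contractionFactor j (t := 0) ⟨le_rfl, zero_le_one⟩
    have small : ∀ k < N, j ≤ k → |u.1 k| ≤ δ ∧ ∀ c ∈ Icc (0 : ℝ) 1, |c * v.1 k - u.1 k| ≤ δ := by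
      intro k hk hjk
      have huv : u.1 j * v.1 j ≤ 0 := hcase.resolve_left (by omega)
      have hd := hv j (by omega)
      have hb : |u.1 j| ≤ δ ∧ |v.1 j| ≤ δ ∧ ∀ c ∈ Icc (0 : ℝ) 1, |c * v.1 j - u.1 j| ≤ δ := by
        rcases mul_nonpos_iff.1 huv with ⟨hx, hy⟩ | ⟨hx, hy⟩ <;>
        · rw [abs_le] at hd
          refine ⟨abs_le.2 ⟨by linarith, by linarith⟩, abs_le.2 ⟨by linarith, by linarith⟩,
            fun c hc => abs_le.2 ⟨by nlinarith [hc.1, hc.2], by nlinarith [hc.1, hc.2]⟩⟩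
      rcases hjk.eq_or_lt with rfl | hjk
      · exact ⟨hb.1, hb.2.2⟩
      · have hu0 := u.2.eq_zero_of_lt (hb.1.trans_lt hδ).ne hjk
        have hv0 := v.2.eq_zero_of_lt (hb.2.1.trans_lt hδ).ne hjk
        have := (abs_nonneg _).trans hd
        simp [hu0, hv0, this]
    refine ⟨ρ, ρ, hρ, hρ, Subtype.ext (funext fun k => ?_), fun r hr k hk => ?_,
      fun r hr k hk => ?_⟩
    · rw [contract_apply, contract_apply]
      rcases lt_trichotomy k j with h | rfl | h
      · rw [hlt k h]
      · simp [h1]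
      · simp [h3 k h]
    · rw [contract_apply]
      rcases lt_or_ge k j with h | h
      · rw [h2 k h r hr.2, one_mul, sub_self, abs_zero]
        exact (abs_nonneg _).trans (hv k hk)
      · exact (shrink (contractionFactor_mem k r) (small k hk h).1).2
    · rw [contract_apply]
      rcases lt_or_ge k j with h | h
      · rw [h2 k h r hr.2, one_mul]
        exact hv k hk
      · exact (small k hk h).2 _ (contractionFactor_mem k r)
  -- With equal signs at j, the point of smaller modulus there is an ancestor of the other. Only the
  -- other one moves, until its factor at j is the ratio of the two coordinates.
  push Not at hcase
  obtain ⟨hjN, hpos⟩ := hcase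
  have hd := hv j hjN
  rcases le_or_gt |u.1 j| |v.1 j| with hle | hle
  · have hv0 : v.1 j ≠ 0 := right_ne_zero_of_mul hpos.ne'
    have ht : u.1 j / v.1 j ∈ Icc (0 : ℝ) 1 := by
      refine ⟨?_, ?_⟩
      · rw [← mul_div_mul_right _ _ hv0]
        exact div_nonneg hpos.le (mul_self_nonneg _)
      · refine (le_abs_self _).trans ?_
        rw [abs_div]
        exact div_le_one_of_le₀ hle (abs_nonneg _)
    have hu1 : |u.1 j| ≠ 1 := by
      intro h
      have h' : |v.1 j| = 1 := le_antisymm (v.2.abs_le_one j) (h ▸ hle)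
      rcases abs_eq_abs.1 (h.trans h'.symm) with h'' | h''
      · exact hj h''
      · rw [h''] at hpos
        nlinarith [mul_self_nonneg (v.1 j)]
    have hu0 : ∀ k > j, u.1 k = 0 := fun k hk => u.2.eq_zero_of_lt hu1 hk
    obtain ⟨ρ, hρ, h1, h2, h3⟩ := exists_contractionFactor j ht
    refine ⟨0, ρ, le_rfl, hρ, Subtype.ext (funext fun k => ?_), fun r hr k hk => ?_,
      fun r hr k hk => ?_⟩
    · rw [contract_zero, contract_apply]
      rcases lt_trichotomy k j with h | rfl | h
      · rw [h2 k h ρ le_rfl, one_mul, hlt k h]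
      · rw [h1, div_mul_cancel₀ _ hv0]
      · rw [h3 k h, zero_mul, hu0 k h]
    · obtain rfl : r = 0 := le_antisymm hr.2 hr.1
      rw [contract_zero, sub_self, abs_zero]
      exact (abs_nonneg _).trans hd
    · rw [contract_apply]
      rcases lt_trichotomy k j with h | rfl | h
      · rw [h2 k h r hr.2, one_mul]
        exact hv k hk
      · have hc1 := antitone_contractionFactor k hr.2
        rw [h1] at hc1
        have e : contractionFactor k r * v.1 k - u.1 k =
            (contractionFactor k r - u.1 k / v.1 k) * v.1 k := by field_simp
        have e' : v.1 k - u.1 k = (1 - u.1 k / v.1 k) * v.1 k := by field_simp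
        rw [e, abs_mul, abs_of_nonneg (by linarith)]
        rw [e', abs_mul, abs_of_nonneg (by linarith [ht.2])] at hd
        refine le_trans ?_ hd
        gcongr
        exact (contractionFactor_mem k r).2
      · have := hv k hk
        rw [hu0 k h, sub_zero] at this ⊢
        exact (shrink (contractionFactor_mem k r) this).1
  · have hu0 : u.1 j ≠ 0 := left_ne_zero_of_mul hpos.ne'
    have ht : v.1 j / u.1 j ∈ Icc (0 : ℝ) 1 := by
      refine ⟨?_, ?_⟩
      · rw [← mul_div_mul_right _ _ hu0, mul_comm]
        exact div_nonneg hpos.le (mul_self_nonneg _)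
      · refine (le_abs_self _).trans ?_
        rw [abs_div]
        exact div_le_one_of_le₀ hle.le (abs_nonneg _)
    have hv0 : ∀ k > j, v.1 k = 0 := fun k hk =>
      v.2.eq_zero_of_lt (hle.trans_le (u.2.abs_le_one j)).ne hk
    obtain ⟨ρ, hρ, h1, h2, h3⟩ := exists_contractionFactor j ht
    refine ⟨ρ, 0, hρ, le_rfl, Subtype.ext (funext fun k => ?_), fun r hr k hk => ?_,
      fun r hr k hk => ?_⟩
    · rw [contract_zero, contract_apply]
      rcases lt_trichotomy k j with h | rfl | h
      · rw [h2 k h ρ le_rfl, one_mul, hlt k h]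
      · rw [h1, div_mul_cancel₀ _ hu0]
      · rw [h3 k h, zero_mul, hv0 k h]
    · rw [contract_apply]
      rcases lt_trichotomy k j with h | rfl | h
      · rw [h2 k h r hr.2, one_mul, sub_self, abs_zero]
        exact (abs_nonneg _).trans hd
      · have hc1 := antitone_contractionFactor k hr.2
        rw [h1] at hc1
        have e : contractionFactor k r * u.1 k - u.1 k =
            -((1 - contractionFactor k r) * u.1 k) := by ring
        have e' : v.1 k - u.1 k = -((1 - v.1 k / u.1 k) * u.1 k) := by
          field_simp
          ring
        rw [e, abs_neg, abs_mul,
          abs_of_nonneg (by linarith [(contractionFactor_mem k r).2])]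
        rw [e', abs_neg, abs_mul, abs_of_nonneg (by linarith [ht.2])] at hd
        refine le_trans ?_ hd
        gcongr
      · have := hv k hk
        rw [hv0 k h, zero_sub, abs_neg] at this
        exact (shrink (contractionFactor_mem k r) this).2
    · obtain rfl : r = 0 := le_antisymm hr.2 hr.1
      rw [contract_zero]
      exact hv k hk

instance : LocallyConnectedSpace (GapTree G) := by
  refine locallyConnectedSpace_iff_connected_subsets.2 fun u U hU => ?_
  obtain ⟨N, δ, hδ, hNU⟩ := mem_nhds_iff.1 hU
  set η := min δ (1 / 2) with hη
  have hη0 : 0 < η := lt_min hδ (by norm_num)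
  refine ⟨{v | ∀ k < N, |v.1 k - u.1 k| ≤ η}, mem_nhds_iff.2 ⟨N, η, hη0, Subset.rfl⟩, ?_,
    fun v hv => hNU fun k hk => (hv k hk).trans (min_le_left _ _)⟩
  refine isPreconnected_of_forall u fun v hv => ?_
  rcases eq_or_ne u v with rfl | hne
  · exact ⟨{u}, by simpa using hv, rfl, rfl, isPreconnected_singleton⟩
  obtain ⟨ρ, ρ', hρ, hρ', heq, h1, h2⟩ :=
    exists_contract_eq ((min_le_right δ (1 / 2)).trans_lt (by norm_num)) hne hv
  refine ⟨(fun r => contract r u) '' Icc 0 ρ ∪ (fun r => contract r v) '' Icc 0 ρ', ?_,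
    Or.inl ⟨0, ⟨le_rfl, hρ⟩, contract_zero u⟩, Or.inr ⟨0, ⟨le_rfl, hρ'⟩, contract_zero v⟩, ?_⟩
  · rintro _ (⟨r, hr, rfl⟩ | ⟨r, hr, rfl⟩)
    exacts [h1 r hr, h2 r hr]
  · exact (isPreconnected_contract_image u ρ).union (contract ρ u) ⟨ρ, ⟨hρ, le_rfl⟩, rfl⟩
      ⟨ρ', ⟨hρ', le_rfl⟩, heq.symm⟩ (isPreconnected_contract_image v ρ')

/-- Here v leaves the branch point at level j in direction s and goes further than u. The cut point
lies on that edge, strictly between, at a level c that is positive so that it is not the branch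
point itself. -/
theorem separatedByPoint_of_lt {u v : GapTree G} {j : ℕ} {s : ℝ} (hs : |s| = 1)
    (hlt : ∀ k < j, u.1 k = v.1 k) (h0 : 0 < s * v.1 j) (huv : s * u.1 j < s * v.1 j) :
    SeparatedByPoint u v := by
  obtain ⟨c, hc, hcv⟩ := exists_between (max_lt h0 huv)
  obtain ⟨hc0, huc⟩ := max_lt_iff.1 hc
  have hss : s * s = 1 := by rw [← abs_mul_abs_self, hs, one_mul]
  have hv0 : v.1 j ≠ 0 := right_ne_zero_of_mul h0.ne'
  have hv1 : ∀ k < j, |v.1 k| = 1 := fun k hk => v.2.abs_eq_one_of_lt hv0 hk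
  have abs_s : ∀ x, |s * x| = |x| := fun x => by rw [abs_mul, hs, one_mul]
  have hc1 : c < 1 := by
    have := (le_abs_self _).trans ((abs_s _).le.trans (v.2.abs_le_one j))
    linarith
  have ht : c / (s * v.1 j) ∈ Icc (0 : ℝ) 1 :=
    ⟨(div_pos hc0 h0).le, div_le_one_of_le₀ hcv.le h0.le⟩
  obtain ⟨ρ, hρ, h1, h2, h3⟩ := exists_contractionFactor j ht
  have hp : s * (contract ρ v).1 j = c := by
    rw [contract_apply, h1, mul_left_comm, div_mul_cancel₀ _ h0.ne']
  have hp' : ∀ k < j, (contract ρ v).1 k = v.1 k := fun k hk => by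
    rw [contract_apply, h2 k hk ρ le_rfl, one_mul]
  -- The second set is the part of the tree beyond the cut point. A point reaching past level j has
  -- all its earlier coordinates ±1, so agreement with v there amounts to positive products and
  -- disagreement to products below 1, both open conditions.
  refine ⟨contract ρ v, {w | s * w.1 j < c} ∪ ⋃ k ∈ Iio j, {w | w.1 k * v.1 k < 1},
    {w | c < s * w.1 j} ∩ ⋂ k ∈ Iio j, {w | 0 < w.1 k * v.1 k}, ?_, ?_, ?_, ?_, ?_, ?_, ?_, ?_⟩
  · refine (isOpen_lt (continuous_const.mul (continuous_apply j)) continuous_const).union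
      (isOpen_biUnion fun k _ =>
        isOpen_lt ((continuous_apply k).mul continuous_const) continuous_const)
  · refine (isOpen_lt continuous_const (continuous_const.mul (continuous_apply j))).inter
      ((finite_Iio j).isOpen_biInter fun k _ =>
        isOpen_lt continuous_const ((continuous_apply k).mul continuous_const))
  · rw [disjoint_left]
    rintro w hwA ⟨hwB, hwB'⟩
    simp only [mem_iInter, mem_ofPred_eq] at hwB hwB'
    rcases hwA with hwA | hwA
    · exact lt_asymm hwA hwB
    · simp only [mem_iUnion, mem_ofPred_eq] at hwA
      obtain ⟨k, hk, hwk⟩ := hwA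
      have hw0 : w.1 j ≠ 0 := right_ne_zero_of_mul (hc0.trans hwB).ne'
      have : |w.1 k * v.1 k| = 1 := by
        rw [abs_mul, hv1 k hk, w.2.abs_eq_one_of_lt hw0 hk, one_mul]
      rw [abs_of_pos (hwB' k hk)] at this
      linarith
  · exact Or.inl huc
  · refine ⟨hcv, ?_⟩
    simp only [mem_iInter, mem_ofPred_eq]
    intro k hk
    rw [← abs_mul_abs_self, hv1 k hk]
    norm_num
  · rintro (h | h)
    · exact h.ne hp
    · simp only [mem_iUnion, mem_ofPred_eq] at h
      obtain ⟨k, hk, hwk⟩ := h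
      rw [hp' k hk, ← abs_mul_abs_self, hv1 k hk] at hwk
      norm_num at hwk
  · rintro ⟨h, -⟩
    exact h.ne' hp
  · intro w hw
    by_contra hcon
    simp only [mem_union, mem_inter_iff, mem_iUnion, mem_iInter, mem_ofPred_eq, not_or] at hcon
    obtain ⟨⟨hA, hA'⟩, hB⟩ := hcon
    push Not at hA hA' hB
    have hwc : s * w.1 j = c := by
      refine le_antisymm (le_of_not_gt fun h => ?_) hA
      obtain ⟨k, hk, hk'⟩ := hB h
      linarith [hA' k hk]
    refine hw (Subtype.ext (funext fun k => ?_))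
    rcases lt_trichotomy k j with h | rfl | h
    · rw [hp' k h]
      have h4 := hA' k h
      have h5 := abs_le.1 (w.2.abs_le_one k)
      rcases (abs_eq zero_le_one).1 (hv1 k h) with h6 | h6 <;> rw [h6] at h4 ⊢ <;> linarith
    · have := congrArg (s * ·) (hwc.trans hp.symm)
      simpa only [← mul_assoc, hss, one_mul] using this
    · rw [contract_apply, h3 k h, zero_mul]
      refine w.2.eq_zero_of_lt ?_ h
      rw [← abs_s, hwc, abs_of_pos hc0]
      exact hc1.ne

theorem separatedByPoint {u v : GapTree G} (h : u ≠ v) : SeparatedByPoint u v := by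
  obtain ⟨j, hj, hlt⟩ := exists_first_ne h
  have key : ∀ u v : GapTree G, (∀ k < j, u.1 k = v.1 k) → u.1 j < v.1 j →
      SeparatedByPoint u v := by
    intro u v hlt hj
    rcases lt_or_ge 0 (v.1 j) with h0 | h0
    · exact separatedByPoint_of_lt (s := 1) (by simp) hlt (by simpa) (by simpa)
    -- Here u j < v j ≤ 0, so in the negative direction u is the further point and the roles are
    -- exchanged.
    · exact (separatedByPoint_of_lt (s := -1) (by simp) (fun k hk => (hlt k hk).symm)
        (by linarith) (by linarith)).symm
  rcases lt_or_gt_of_ne hj with h | h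
  · exact key u v hlt h
  · exact (key v u (fun k hk => (hlt k hk).symm) h).symm

theorem isDendrite (G : Set ℕ) : IsDendrite (GapTree G) :=
  ⟨inferInstance, inferInstance, inferInstance, not_isEmbedding_circle fun _ _ => separatedByPoint⟩

end GapTree

/-! ### Bounding polynomial entropy by counting. -/

section Separated

variable {X : Type*} [MetricSpace X] {f : X → X} {n : ℕ} {ε : ℝ}

theorem sepNumber_le_card {ι : Type*} (s : Finset ι) (P : ι → X → Prop)
    (cover : ∀ x, ∃ c ∈ s, P c x)
    (close : ∀ c x y, P c x → P c y → ∀ i < n, dist (f^[i] x) (f^[i] y) ≤ ε) :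
    sepNumber f n ε ≤ s.card := by
  choose code hcode hP using cover
  refine iSup₂_le fun S hS => ?_
  rw [← Set.encard_coe_eq_coe_finsetCard]
  refine encard_le_encard_of_injOn (f := code) (fun x _ => hcode x) fun x hx y hy hxy => ?_
  by_contra hne
  obtain ⟨i, hi, hd⟩ := hS x hx y hy hne
  exact (close _ x y (hP x) (hxy ▸ hP y) i hi).not_gt hd

theorem card_le_sepNumber {ι : Type*} (s : Finset ι) (g : ι → X) (hε : 0 ≤ ε)
    (hg : ∀ c ∈ s, ∀ c' ∈ s, c ≠ c' → ∃ i < n, ε < dist (f^[i] (g c)) (f^[i] (g c'))) :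
    s.card ≤ sepNumber f n ε := by
  have hinj : InjOn g s := by
    intro c hc c' hc' h
    by_contra hne
    obtain ⟨i, -, hd⟩ := hg c hc c' hc' hne
    rw [h, dist_self] at hd
    exact hd.not_ge hε
  rw [← Set.encard_coe_eq_coe_finsetCard, ← hinj.encard_image]
  refine le_iSup₂_of_le (g '' s) ?_ le_rfl
  rintro _ ⟨c, hc, rfl⟩ _ ⟨c', hc', rfl⟩ hne
  exact hg c hc c' hc' fun h => hne (h ▸ rfl)

theorem tendsto_log_mul_rpow_div_log {C : ℝ} (hC : 0 < C) (α : ℝ) :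
    Tendsto (fun n : ℕ => Real.log (C * (n : ℝ) ^ α) / Real.log n) atTop (𝓝 α) := by
  have hlog : Tendsto (fun n : ℕ => Real.log n) atTop atTop :=
    Real.tendsto_log_atTop.comp tendsto_natCast_atTop_atTop
  have : Tendsto (fun n : ℕ => Real.log C / Real.log n + α) atTop (𝓝 (0 + α)) :=
    (hlog.const_div_atTop _).add_const α
  rw [zero_add] at this
  refine this.congr' ?_
  filter_upwards [eventually_gt_atTop 1] with n hn
  have h0 : (0 : ℝ) < n := by positivity
  have h1 : Real.log n ≠ 0 := (Real.log_pos (by exact_mod_cast hn)).ne'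
  rw [Real.log_mul hC.ne' (Real.rpow_pos_of_pos h0 α).ne', Real.log_rpow h0]
  field_simp

theorem limsup_log_mul_rpow_div_log {C : ℝ} (hC : 0 < C) (α : ℝ) :
    limsup (fun n : ℕ => ENNReal.log (ENNReal.ofReal (C * (n : ℝ) ^ α)) / (Real.log n : EReal))
      atTop = α := by
  have h : Tendsto (fun n : ℕ => ((Real.log (C * (n : ℝ) ^ α) / Real.log n : ℝ) : EReal)) atTop
      (𝓝 (α : EReal)) :=
    (continuous_coe_real_ereal.tendsto α).comp (tendsto_log_mul_rpow_div_log hC α)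
  refine (h.congr' ?_).limsup_eq
  filter_upwards [eventually_gt_atTop 0] with n hn
  have h0 : (0 : ℝ) < n := by positivity
  rw [ENNReal.log_ofReal_of_pos (by positivity), EReal.coe_div]

theorem polyEntropyAt_le_of_sepNumber_le {C α : ℝ} (hC : 0 < C)
    (h : ∀ᶠ n : ℕ in atTop, ∃ K : ℕ, sepNumber f n ε ≤ K ∧ (K : ℝ) ≤ C * (n : ℝ) ^ α) :
    polyEntropyAt f ε ≤ α := by
  rw [← limsup_log_mul_rpow_div_log hC α]
  refine limsup_le_limsup ?_
  filter_upwards [h] with n ⟨K, hK, hKC⟩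
  refine EReal.div_le_div_right_of_nonneg (by exact_mod_cast Real.log_natCast_nonneg n)
    (ENNReal.log_monotone ?_)
  calc (sepNumber f n ε : ENNReal) ≤ ((K : ℕ∞) : ENNReal) := by exact_mod_cast hK
    _ = ENNReal.ofReal K := by simp
    _ ≤ _ := ENNReal.ofReal_le_ofReal hKC

theorem le_polyEntropyAt_of_le_sepNumber {C α : ℝ} (hC : 0 < C)
    (h : ∀ᶠ n : ℕ in atTop, ∃ K : ℕ, K ≤ sepNumber f n ε ∧ C * (n : ℝ) ^ α ≤ K) :
    α ≤ polyEntropyAt f ε := by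
  rw [← limsup_log_mul_rpow_div_log hC α]
  refine limsup_le_limsup ?_
  filter_upwards [h] with n ⟨K, hK, hKC⟩
  refine EReal.div_le_div_right_of_nonneg (by exact_mod_cast Real.log_natCast_nonneg n)
    (ENNReal.log_monotone ?_)
  calc _ ≤ ENNReal.ofReal K := ENNReal.ofReal_le_ofReal hKC
    _ = ((K : ℕ∞) : ENNReal) := by simp
    _ ≤ (sepNumber f n ε : ENNReal) := by exact_mod_cast hK

end Separated

/-! ### A set of gaps with prescribed growth. -/

/-- The set of jumps of the sequence `⌊k ^ γ⌋₊`. -/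
def jumpSet (γ : ℝ) : Set ℕ := {k | ⌊(k : ℝ) ^ γ⌋₊ < ⌊((k + 1 : ℕ) : ℝ) ^ γ⌋₊}

-- Since x ↦ x^γ is subadditive for γ ≤ 1, the integer parts increase by at most one at each step,
-- so counting jumps telescopes.
open Classical in
theorem card_filter_jumpSet {γ : ℝ} (hγ : γ ∈ Ioo (0 : ℝ) 1) (n : ℕ) :
    ((Finset.range n).filter (· ∈ jumpSet γ)).card = ⌊(n : ℝ) ^ γ⌋₊ := by
  induction n with
  | zero => simp [Real.zero_rpow hγ.1.ne']
  | succ n ih =>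
    have hle : ⌊(n : ℝ) ^ γ⌋₊ ≤ ⌊((n + 1 : ℕ) : ℝ) ^ γ⌋₊ :=
      Nat.floor_mono (Real.rpow_le_rpow n.cast_nonneg (by simp) hγ.1.le)
    have hle' : ⌊((n + 1 : ℕ) : ℝ) ^ γ⌋₊ ≤ ⌊(n : ℝ) ^ γ⌋₊ + 1 := by
      rw [← Nat.floor_add_one (by positivity)]
      refine Nat.floor_mono ?_
      simpa using Real.rpow_add_le_add_rpow n.cast_nonneg zero_le_one hγ.1.le hγ.2.le
    rw [Finset.range_add_one, Finset.filter_insert]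
    by_cases h : n ∈ jumpSet γ
    · have h' : ⌊(n : ℝ) ^ γ⌋₊ < ⌊((n + 1 : ℕ) : ℝ) ^ γ⌋₊ := h
      rw [if_pos h, Finset.card_insert_of_notMem (by simp), ih]
      omega
    · have h' : ¬ ⌊(n : ℝ) ^ γ⌋₊ < ⌊((n + 1 : ℕ) : ℝ) ^ γ⌋₊ := h
      rw [if_neg h, ih]
      omega

/-! ### The shift and its polynomial entropy. -/

namespace GapTree

variable {G : Set ℕ}

def shift (u : GapTree G) : GapTree G :=
  ⟨fun k => u.1 (k + 1), fun k => u.2.abs_le_one _, fun k => u.2.eq_zero_or _,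
    fun i g hi hg => u.2.gap_mem (i + 1) g hi (by convert hg using 2; ring),
    fun i j k hij hjk hi hj => u.2.nonpos_of_lt (i + 1) (j + 1) (k + 1) (by omega) (by omega) hi hj⟩

theorem iterate_shift_apply (n : ℕ) (u : GapTree G) (k : ℕ) :
    (shift^[n] u).1 k = u.1 (k + n) := by
  induction n generalizing u with
  | zero => rfl
  | succ n ih =>
    rw [Function.iterate_succ_apply, ih]
    rfl

theorem continuous_shift : Continuous (shift : GapTree G → GapTree G) :=
  continuous_iff.2 fun k => continuous_apply (k + 1)

theorem surjective_shift : Function.Surjective (shift : GapTree G → GapTree G) := by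
  intro u
  -- Prepending -1 adds no positive sign and permits any continuation.
  let w : ℕ → ℝ := fun k => Nat.casesOn k (-1) u.1
  have hw : IsGapPoint G w := by
    refine ⟨?_, ?_, ?_, ?_⟩
    · rintro (_ | k)
      · simp [w]
      · exact u.2.abs_le_one k
    · rintro (_ | k)
      · simp [w]
      · exact u.2.eq_zero_or k
    · rintro (_ | i) g hi hg
      · norm_num [w] at hi
      · refine u.2.gap_mem i g hi ?_
        have e : i + 1 + g + 1 = (i + g + 1) + 1 := by ring
        rwa [e] at hg
    · rintro (_ | i) (_ | j) (_ | k) hij hjk hi hj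
      any_goals omega
      · norm_num [w] at hi
      · exact u.2.nonpos_of_lt i j k (by omega) (by omega) hi hj
  exact ⟨⟨w, hw⟩, rfl⟩

theorem dist_def (u v : GapTree G) :
    dist u v = ∑' k : ℕ, min (2⁻¹ ^ k) |u.1 k - v.1 k| := rfl

theorem summable_dist (u v : GapTree G) :
    Summable fun k : ℕ => min (2⁻¹ ^ k) |u.1 k - v.1 k| :=
  PiCountable.dist_summable u.1 v.1

theorem min_one_le_dist (u v : GapTree G) : min 1 |u.1 0 - v.1 0| ≤ dist u v := by
  rw [dist_def]
  simpa using (summable_dist u v).le_tsum 0 fun k _ => le_min (by positivity) (abs_nonneg _)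

theorem exists_dist_le {ε : ℝ} (hε : 0 < ε) : ∃ (N : ℕ) (δ : ℝ), 0 < δ ∧
    ∀ u v : GapTree G, (∀ k < N, |u.1 k - v.1 k| ≤ δ) → dist u v ≤ ε := by
  obtain ⟨N, hN⟩ := exists_pow_lt_of_lt_one (show 0 < ε / 4 by positivity)
    (show (2⁻¹ : ℝ) < 1 by norm_num)
  refine ⟨N, ε / (2 * (N + 1)), by positivity, fun u v h => ?_⟩
  rw [dist_def, ← (summable_dist u v).sum_add_tsum_nat_add N]
  have h1 : ∑ k ∈ Finset.range N, min (2⁻¹ ^ k) |u.1 k - v.1 k| ≤ ε / 2 := by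
    refine (Finset.sum_le_card_nsmul _ _ (ε / (2 * (N + 1))) fun k hk =>
      (min_le_right _ _).trans (h k (Finset.mem_range.1 hk))).trans ?_
    rw [Finset.card_range, nsmul_eq_mul, mul_div_assoc', div_le_div_iff₀ (by positivity) two_pos]
    nlinarith
  have hgeo : HasSum (fun k : ℕ => (2⁻¹ : ℝ) ^ (k + N)) (2 * 2⁻¹ ^ N) := by
    simp_rw [pow_add]
    have := (hasSum_geometric_of_lt_one (show (0 : ℝ) ≤ 2⁻¹ by norm_num) (by norm_num)).mul_right
      ((2⁻¹ : ℝ) ^ N)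
    rwa [show (1 - 2⁻¹ : ℝ)⁻¹ = 2 by norm_num] at this
  have h2 : ∑' k, min (2⁻¹ ^ (k + N)) |u.1 (k + N) - v.1 (k + N)| ≤ 2 * 2⁻¹ ^ N := by
    rw [← hgeo.tsum_eq]
    exact ((summable_nat_add_iff N).2 (summable_dist u v)).tsum_le_tsum
      (fun k => min_le_left _ _) hgeo.summable
  linarith

/-- The sequence with signs `1` at the positions `a` and `b` and `-1` elsewhere, cut off at the
coordinate `h`, where it takes the value `t`. -/
noncomputable def pattern (h : ℕ) (t : ℝ) (a b : ℕ) (k : ℕ) : ℝ :=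
  if k < h then if k = a ∨ k = b then 1 else -1 else if k = h then t else 0

theorem isGapPoint_pattern {h a g : ℕ} (hg : g ∈ G) :
    IsGapPoint G (pattern h 0 a (a + g + 1)) := by
  have pos : ∀ {k}, 0 < pattern h 0 a (a + g + 1) k → k = a ∨ k = a + g + 1 := by
    intro k hk
    unfold pattern at hk
    split_ifs at hk with h1 h2 <;> first | exact h2 | norm_num at hk
  refine ⟨fun k => ?_, fun k => ?_, fun i g' hi hj => ?_, fun i j k hij hjk hi hj => ?_⟩
  · unfold pattern
    split_ifs <;> simp
  · rcases lt_or_ge k h with hk | hk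
    · right
      unfold pattern
      split_ifs <;> simp
    · left
      unfold pattern
      split_ifs <;> first | omega | rfl
  · have h1 := pos hi
    have h2 := pos hj
    have : g' = g := by omega
    exact this ▸ hg
  · by_contra! hk
    have h1 := pos hi
    have h2 := pos hj
    have h3 := pos hk
    omega

theorem exists_pattern (u : GapTree G) (L : ℕ) : ∃ h ≤ L, ∃ a ≤ L, ∃ b,
    (b = a ∨ ∃ g ∈ G, g < L ∧ b = a + g + 1) ∧ ∀ k < L, u.1 k = pattern h (u.1 h) a b k := by
  classical
  obtain ⟨h, hhL, hone, hzero⟩ : ∃ h ≤ L, (∀ k < h, |u.1 k| = 1) ∧ ∀ k < L, h < k → u.1 k = 0 := by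
    by_cases hex : ∃ h, h < L ∧ |u.1 h| ≠ 1
    · obtain ⟨hlt, hne⟩ := Nat.find_spec hex
      refine ⟨Nat.find hex, hlt.le, fun k hk => ?_, fun k _ hk => u.2.eq_zero_of_lt hne hk⟩
      by_contra hk'
      exact Nat.find_min hex hk ⟨hk.trans hlt, hk'⟩
    · push Not at hex
      exact ⟨L, le_rfl, hex, fun k hk hk' => by omega⟩
  obtain ⟨a, haL, b, hab, hiff⟩ : ∃ a ≤ L, ∃ b, (b = a ∨ ∃ g ∈ G, g < L ∧ b = a + g + 1) ∧
      ∀ k < h, 0 < u.1 k ↔ k = a ∨ k = b := by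
    by_cases hex : ∃ a, a < h ∧ 0 < u.1 a
    · obtain ⟨halt, hapos⟩ := Nat.find_spec hex
      have hmin : ∀ k < h, 0 < u.1 k → Nat.find hex ≤ k := fun k hk hk' =>
        Nat.find_min' hex ⟨hk, hk'⟩
      set a := Nat.find hex
      by_cases hex' : ∃ b, a < b ∧ b < h ∧ 0 < u.1 b
      · obtain ⟨b, hab, hbh, hb⟩ := hex'
        have hb' : b = a + (b - a - 1) + 1 := by omega
        refine ⟨a, by omega, b, Or.inr ⟨b - a - 1, u.2.gap_mem a _ hapos (hb' ▸ hb), by omega, hb'⟩,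
          fun k hk => ⟨fun hkpos => ?_, ?_⟩⟩
        · by_contra! hcon
          have := hmin k hk hkpos
          rcases lt_or_gt_of_ne hcon.2 with hkb | hkb
          · exact (u.2.nonpos_of_lt a k b (by omega) hkb hapos hkpos).not_gt hb
          · exact (u.2.nonpos_of_lt a b k hab hkb hapos hb).not_gt hkpos
        · rintro (rfl | rfl) <;> assumption
      · push Not at hex'
        refine ⟨a, by omega, a, Or.inl rfl, fun k hk => ⟨fun hkpos => ?_, ?_⟩⟩
        · by_contra! hcon
          have := hmin k hk hkpos
          exact (hex' k (by omega) hk).not_gt hkpos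
        · rintro (rfl | rfl) <;> assumption
    · push Not at hex
      -- Without a positive sign the positions are set to L, which is never read below height h ≤ L.
      refine ⟨L, le_rfl, L, Or.inl rfl, fun k hk => ⟨fun hkpos => ?_, by omega⟩⟩
      exact absurd hkpos (hex k hk).not_gt
  refine ⟨h, hhL, a, haL, b, hab, fun k hk => ?_⟩
  unfold pattern
  rcases lt_trichotomy k h with hkh | rfl | hkh
  · rw [if_pos hkh]
    rcases (abs_eq zero_le_one).1 (hone k hkh) with h1 | h1
    · rw [if_pos ((hiff k hkh).1 (by rw [h1]; exact one_pos)), h1]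
    · rw [if_neg (fun hc => by have := (hiff k hkh).2 hc; rw [h1] at this; norm_num at this), h1]
  · simp
  · rw [if_neg (by omega), if_neg (by omega), hzero k hk hkh]

open Classical in
/-- A code consists of a height, an approximate value at that height, and the positions of the
positive signs. -/
theorem sepNumber_shift_le {ε : ℝ} (hε : 0 < ε) : ∃ N M : ℕ, ∀ n,
    sepNumber (shift : GapTree G → GapTree G) n ε ≤
      (((n + N + 1) * (M + 1) * ((n + N + 1) * (((Finset.range (n + N)).filter (· ∈ G)).card + 1)) :
        ℕ) : ℕ∞) := by
  obtain ⟨N, δ, hδ, hdist⟩ := exists_dist_le (G := G) hε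
  obtain ⟨M, hM⟩ := exists_nat_gt (2 / δ)
  refine ⟨N, M, fun n => ?_⟩
  -- The first N coordinates of the first n iterates only involve coordinates below n + N.
  set L := n + N with hL
  set B : Finset (Option ℕ) := ((Finset.range L).filter (· ∈ G)).insertNone with hB
  let s : Finset ((ℕ × ℕ) × (ℕ × Option ℕ)) :=
    (Finset.range (L + 1) ×ˢ Finset.range (M + 1)) ×ˢ (Finset.range (L + 1) ×ˢ B)
  let second : ℕ → Option ℕ → ℕ := fun a o => o.elim a fun g => a + g + 1
  let P : (ℕ × ℕ) × (ℕ × Option ℕ) → GapTree G → Prop := fun c u =>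
    ⌊(u.1 c.1.1 + 1) / δ⌋₊ = c.1.2 ∧
      ∀ k < L, u.1 k = pattern c.1.1 (u.1 c.1.1) c.2.1 (second c.2.1 c.2.2) k
  have hs : s.card = (L + 1) * (M + 1) * ((L + 1) * (((Finset.range L).filter (· ∈ G)).card + 1)) := by
    simp [s, B, Finset.card_product, Finset.card_insertNone]
  rw [← hs]
  refine sepNumber_le_card s P (fun u => ?_) fun c u v hu hv i hi => ?_
  · obtain ⟨h, hh, a, ha, b, hb, hpat⟩ := exists_pattern u L
    have hq : ⌊(u.1 h + 1) / δ⌋₊ ≤ M := by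
      refine Nat.floor_le_of_le (le_trans ?_ hM.le)
      have := (abs_le.1 (u.2.abs_le_one h)).2
      gcongr
      linarith
    obtain ⟨o, ho, rfl⟩ : ∃ o ∈ B, b = second a o := by
      rcases hb with rfl | ⟨g, hg, hgL, rfl⟩
      · exact ⟨none, by simp [B], rfl⟩
      · exact ⟨some g, by simp [B, hg, hgL], rfl⟩
    exact ⟨((h, ⌊(u.1 h + 1) / δ⌋₊), (a, o)), by simp [s]; grind, rfl, hpat⟩
  · refine hdist _ _ fun k hk => ?_
    rw [iterate_shift_apply, iterate_shift_apply, hu.2 _ (by omega), hv.2 _ (by omega)]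
    unfold pattern
    split_ifs
    · simp [hδ.le]
    · simp [hδ.le]
    · have nonneg : ∀ w : GapTree G, 0 ≤ (w.1 c.1.1 + 1) / δ := fun w =>
        div_nonneg (by linarith [(abs_le.1 (w.2.abs_le_one c.1.1)).1]) hδ.le
      have h1 := Nat.floor_le (nonneg u)
      have h2 := Nat.lt_floor_add_one ((u.1 c.1.1 + 1) / δ)
      have h3 := Nat.floor_le (nonneg v)
      have h4 := Nat.lt_floor_add_one ((v.1 c.1.1 + 1) / δ)
      rw [hu.1] at h1 h2
      rw [hv.1] at h3 h4
      rw [le_div_iff₀ hδ] at h1 h3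
      rw [div_lt_iff₀ hδ] at h2 h4
      exact abs_le.2 ⟨by linarith, by linarith⟩
    · simp [hδ.le]

-- First positions and gaps below m put both positive signs below 2m, and the cut-off is placed in
-- [2m + 1, 3m], above them. Distinct triples then differ by at least 1 at some coordinate i < n,
-- which the i-th iterate brings to coordinate 0.
open Classical in
theorem le_sepNumber_shift {ε : ℝ} (hε : 0 ≤ ε) (hε1 : ε < 1) (m n : ℕ) (hmn : 3 * m < n) :
    ((m * (m * ((Finset.range m).filter (· ∈ G)).card) : ℕ) : ℕ∞) ≤
      sepNumber (shift : GapTree G → GapTree G) n ε := by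
  set B := (Finset.range m).filter (· ∈ G) with hB
  let s := Finset.range m ×ˢ (Finset.range m ×ˢ B)
  have hs : s.card = m * (m * B.card) := by simp [s, Finset.card_product]
  have hG : ∀ c ∈ s, c.2.2 ∈ G := fun c hc => by simp [s, B] at hc; tauto
  have hr : IsGapPoint G 0 := ⟨by simp, by simp, by simp, by simp⟩
  let g : ℕ × ℕ × ℕ → GapTree G := fun c =>
    if hc : c.2.2 ∈ G then
      ⟨pattern (2 * m + 1 + c.1) 0 c.2.1 (c.2.1 + c.2.2 + 1), isGapPoint_pattern hc⟩
    else ⟨0, hr⟩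
  rw [← hs]
  refine card_le_sepNumber s g hε fun c hc c' hc' hne => ?_
  have hgc : (g c).1 = pattern (2 * m + 1 + c.1) 0 c.2.1 (c.2.1 + c.2.2 + 1) := by
    simp [g, hG c hc]
  have hgc' : (g c').1 = pattern (2 * m + 1 + c'.1) 0 c'.2.1 (c'.2.1 + c'.2.2 + 1) := by
    simp [g, hG c' hc']
  have hval : ∃ i < n, 1 ≤ |(g c).1 i - (g c').1 i| := by
    obtain ⟨h, a, b⟩ := c
    obtain ⟨h', a', b'⟩ := c'
    simp only [s, B, Finset.mem_product, Finset.mem_range, Finset.mem_filter] at hc hc'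
    simp only [hgc, hgc']
    by_contra! hcon
    refine hne ?_
    have hh : h = h' := by
      have h1 := hcon (2 * m + 1 + h) (by omega)
      have h2 := hcon (2 * m + 1 + h') (by omega)
      by_contra hne'
      rcases lt_or_gt_of_ne hne' with hlt | hlt
      · unfold pattern at h1
        rw [if_neg (by omega), if_pos rfl, if_pos (by omega), if_neg (by omega)] at h1
        norm_num at h1
      · unfold pattern at h2
        rw [if_pos (by omega), if_neg (by omega), if_neg (by omega), if_pos rfl] at h2
        norm_num at h2
    subst hh
    have key : ∀ k ≤ 2 * m, (k = a ∨ k = a + b + 1 ↔ k = a' ∨ k = a' + b' + 1) := by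
      intro k hk
      have h1 := hcon k (by omega)
      have hlt : k < 2 * m + 1 + h := by omega
      unfold pattern at h1
      rw [if_pos hlt, if_pos hlt] at h1
      split_ifs at h1 with h2 h3 h3
      · tauto
      · norm_num at h1
      · norm_num at h1
      · tauto
    have k1 := key a (by omega)
    have k2 := key a' (by omega)
    have k3 := key (a + b + 1) (by omega)
    have k4 := key (a' + b' + 1) (by omega)
    simp only [Prod.mk.injEq, true_and]
    omega
  obtain ⟨i, hi, hi1⟩ := hval
  refine ⟨i, hi, hε1.trans_le (le_trans ?_ (min_one_le_dist _ _))⟩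
  rw [iterate_shift_apply, iterate_shift_apply, zero_add]
  exact le_min le_rfl hi1

theorem polyEntropy_shift {γ : ℝ} (hγ : γ ∈ Ioo (0 : ℝ) 1) :
    polyEntropy (shift : GapTree (jumpSet γ) → GapTree (jumpSet γ)) = ((2 + γ : ℝ) : EReal) := by
  have rpow_split : ∀ {x : ℝ}, 0 < x → x ^ (2 + γ) = x * x * x ^ γ := fun {x} hx => by
    rw [Real.rpow_add hx, Real.rpow_two, sq]
  refine le_antisymm (iSup₂_le fun ε hε => ?_) ?_
  · obtain ⟨N, M, h⟩ := sepNumber_shift_le (G := jumpSet γ) hε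
    have hN : (0 : ℝ) < (N + 2 : ℝ) := by positivity
    -- For n ≥ 1, n + N + 1 ≤ (N + 2) n; the factor 2 absorbs the code for a missing second sign.
    refine polyEntropyAt_le_of_sepNumber_le (C := (N + 2) ^ (2 + γ) * (2 * (M + 1)))
      (by positivity) ?_
    filter_upwards [eventually_gt_atTop 0] with n hn
    refine ⟨_, h n, ?_⟩
    rw [card_filter_jumpSet hγ]
    have hn1 : (1 : ℝ) ≤ n := by exact_mod_cast hn
    have hL : ((n + N : ℕ) : ℝ) + 1 ≤ (N + 2) * n := by
      push_cast
      nlinarith [(Nat.cast_nonneg N : (0 : ℝ) ≤ N)]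
    have hx : (1 : ℝ) ≤ (N + 2) * n := le_trans (by simp; positivity) hL
    set x : ℝ := (N + 2) * n with hxdef
    have hx0 : 0 < x := one_pos.trans_le hx
    have hfl : (⌊((n + N : ℕ) : ℝ) ^ γ⌋₊ : ℝ) + 1 ≤ 2 * x ^ γ := by
      have h1 : (⌊((n + N : ℕ) : ℝ) ^ γ⌋₊ : ℝ) ≤ x ^ γ :=
        (Nat.floor_le (by positivity)).trans
          (Real.rpow_le_rpow (by positivity) (by linarith) hγ.1.le)
      have h2 : 1 ≤ x ^ γ := Real.one_le_rpow hx hγ.1.le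
      linarith
    have hgoal : ((N : ℝ) + 2) ^ (2 + γ) * (2 * (M + 1)) * (n : ℝ) ^ (2 + γ) =
        x * (M + 1) * (x * (2 * x ^ γ)) := by
      have : ((N : ℝ) + 2) ^ (2 + γ) * (n : ℝ) ^ (2 + γ) = x * x * x ^ γ := by
        rw [← Real.mul_rpow hN.le (by positivity), ← hxdef, rpow_split hx0]
      linear_combination (2 * (M + 1) : ℝ) * this
    rw [hgoal]
    push_cast at hL hfl ⊢
    gcongr
  · refine le_trans ?_ (le_iSup₂_of_le (1 / 2 : ℝ) (by norm_num) le_rfl)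
    -- The factor 1/12 comes from m = (n - 1) / 3 ≥ n / 12 for n ≥ 4, and 1/2 from ⌊x⌋ ≥ x / 2 for x
    -- ≥ 1.
    refine le_polyEntropyAt_of_le_sepNumber (C := (1 / 12) ^ (2 + γ) * (1 / 2)) (by positivity) ?_
    filter_upwards [eventually_ge_atTop 4] with n hn
    have hm := le_sepNumber_shift (G := jumpSet γ) (ε := 1 / 2) (by norm_num) (by norm_num)
      ((n - 1) / 3) n (by omega)
    refine ⟨_, hm, ?_⟩
    rw [card_filter_jumpSet hγ]
    generalize hmdef : (n - 1) / 3 = m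
    have hm1 : (1 : ℝ) ≤ m := by
      have : 1 ≤ m := by omega
      exact_mod_cast this
    have hmn : 1 / 12 * (n : ℝ) ≤ m := by
      have : n ≤ 12 * m := by omega
      have : (n : ℝ) ≤ 12 * m := by exact_mod_cast this
      linarith
    have hm0 : (0 : ℝ) < m := by linarith
    have hfl : (m : ℝ) ^ γ * (1 / 2) ≤ ⌊(m : ℝ) ^ γ⌋₊ := by
      have h1 : 1 ≤ (m : ℝ) ^ γ := Real.one_le_rpow hm1 hγ.1.le
      have h2 := Nat.lt_floor_add_one ((m : ℝ) ^ γ)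
      have h3 : (1 : ℝ) ≤ ⌊(m : ℝ) ^ γ⌋₊ := by exact_mod_cast Nat.le_floor (by exact_mod_cast h1)
      linarith
    calc (1 / 12 : ℝ) ^ (2 + γ) * (1 / 2) * (n : ℝ) ^ (2 + γ)
        = (1 / 12 * n) ^ (2 + γ) * (1 / 2) := by
          rw [Real.mul_rpow (by norm_num) (by positivity)]
          ring
      _ ≤ (m : ℝ) ^ (2 + γ) * (1 / 2) := by
          gcongr
          linarith [hγ.1]
      _ = m * (m * (m ^ γ * (1 / 2))) := by
          rw [rpow_split hm0]
          ring
      _ ≤ m * (m * ⌊(m : ℝ) ^ γ⌋₊) := by gcongr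
      _ = _ := by push_cast; ring

end GapTree

theorem theorem5p7 (α : ℝ) (hα : α ∈ Ioo (2 : ℝ) 3) :
    ∃ (D : Type) (_ : MetricSpace D) (f : D → D),
      IsDendrite D ∧ Continuous f ∧ Function.Surjective f ∧ polyEntropy f = (α : EReal) := by
  refine ⟨GapTree (jumpSet (α - 2)), inferInstance, GapTree.shift, GapTree.isDendrite _,
    GapTree.continuous_shift, GapTree.surjective_shift, ?_⟩
  rw [GapTree.polyEntropy_shift ⟨by linarith [hα.1], by linarith [hα.2]⟩, add_sub_cancel]
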